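/- Let $\mathbb{K}$ be $\mathbb{R}$ or $\mathbb{C}$ and let $\mathcal{A}$ be a (not necessarily unital) Banach algebra over $\mathbb{K}$. A Banach $\mathcal{A}$-bimodule is a Banach space $\mathcal{X}$ with two jointly continuous bilinear module actions $(a,x)\mapsto a\cdot x$ and $(x,a)\mapsto x\cdot a$ satisfying $(a\cdot x)\cdot b=a\cdot(x\cdot b)$; its dual $\mathcal{X}^*$ is a Banach $\mathcal{A}$-bimodule via $\langle x,f\cdot a\rangle=\langle a\cdot x,f\rangle$ and $\langle x,a\cdot f\rangle=\langle x\cdot a,f\rangle$. A derivation from $\mathcal{A}$ into a Banach $\mathcal{A}$-bimodule $\mathcal{Y}$ is a continuous linear map $D:\mathcal{A}\to\mathcal{Y}$ with $D(ab)=D(a)\cdot b+a\cdot D(b)$; it is semi-inner if there are $\eta,\xi\in\mathcal{Y}$ with $D(a)=a\cdot\eta-\xi\cdot a$ for all $a\in\mathcal{A}$. The algebra $\mathcal{A}$ is semi-amenable if, for every Banach $\mathcal{A}$-bimodule $\mathcal{X}$, every derivation from $\mathcal{A}$ into $\mathcal{X}^*$ is semi-inner. For $f\in\mathcal{A}^*$,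 $a,b\in\mathcal{A}$ and $F,G\in\mathcal{A}^{**}$ put $\langle f\cdot a,b\rangle=f(ab)$, $\langle a\cdot f,b\rangle=f(ba)$, $\langle G\cdot f,a\rangle=\langle G,f\cdot a\rangle$ and $\langle f\cdot F,a\rangle=\langle F,a\cdot f\rangle$. The first and second Arens products on $\mathcal{A}^{**}$ are given by $\langle F\,\square\,G,f\rangle=\langle F,G\cdot f\rangle$ and $\langle F\diamond G,f\rangle=\langle G,f\cdot F\rangle$; with the dual norm, each of them makes $\mathcal{A}^{**}$ a Banach algebra. **Theorem.** If $\mathcal{A}^{**}$, equipped with either the first or the second Arens product, is semi-amenable, then $\mathcal{A}$ is semi-amenable. -/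

import Mathlib

universe u v w

noncomputable section

namespace BanachAlg

/-! ## Banach bimodules, derivations, semi-amenability -/

/-- A Banach `A`-bimodule structure on the Banach space `X`. The two module operations
`left a x = a · x` and `right a x = x · a` are jointly continuous bilinear maps, i.e. continuous
linear maps `A → B(X)`, so that `‖a · x‖ ≤ k ‖a‖ ‖x‖` and `‖x · a‖ ≤ k ‖x‖ ‖a‖`
for some constant `k`. No unit is assumed in `A`. -/
structure Bimodule (𝕜 : Type v) [RCLike 𝕜] (A : Type u) [NonUnitalNormedRing A]
    [NormedSpace 𝕜 A] (X : Type w) [NormedAddCommGroup X] [NormedSpace 𝕜 X] where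
  /-- `left a x` is `a · x`. -/
  left : A →L[𝕜] X →L[𝕜] X
  /-- `right a x` is `x · a`. -/
  right : A →L[𝕜] X →L[𝕜] X
  left_mul : ∀ (a b : A) (x : X), left (a * b) x = left a (left b x)
  right_mul : ∀ (a b : A) (x : X), right (a * b) x = right b (right a x)
  left_right : ∀ (a b : A) (x : X), right b (left a x) = left a (right b x)

section Defs

variable {𝕜 : Type v} [RCLike 𝕜] {A : Type u} [NonUnitalNormedRing A] [NormedSpace 𝕜 A]
variable {X : Type w} [NormedAddCommGroup X] [NormedSpace 𝕜 X]

/-- The dual bimodule `X*`: `⟨x, a · f⟩ = ⟨x · a, f⟩` and `⟨x, f · a⟩ = ⟨a · x, f⟩`. -/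
def Bimodule.dual (M : Bimodule 𝕜 A X) : Bimodule 𝕜 A (StrongDual 𝕜 X) where
  left := ((ContinuousLinearMap.compL 𝕜 X X 𝕜).flip).comp M.right
  right := ((ContinuousLinearMap.compL 𝕜 X X 𝕜).flip).comp M.left
  left_mul a b f := by ext x; simp [M.right_mul]
  right_mul a b f := by ext x; simp [M.left_mul]
  left_right a b f := by ext x; simp [M.left_right]

/-- The continuous linear map `D` is a derivation: `D(ab) = D(a) · b + a · D(b)`. -/
def Bimodule.IsDerivation (M : Bimodule 𝕜 A X) (D : A →L[𝕜] X) : Prop :=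
  ∀ a b : A, D (a * b) = M.right b (D a) + M.left a (D b)

/-- `D` is semi-inner: there are `η, ξ ∈ X` with `D(a) = a · η - ξ · a` for all `a`. -/
def Bimodule.IsSemiInner (M : Bimodule 𝕜 A X) (D : A →L[𝕜] X) : Prop :=
  ∃ η ξ : X, ∀ a : A, D a = M.left a η - M.right a ξ

end Defs

/-- `A` is semi-amenable: for every Banach `A`-bimodule `X` (in the universe `w`), every
continuous derivation from `A` into the dual bimodule `X*` is semi-inner. -/
def IsSemiAmenable (𝕜 : Type v) [RCLike 𝕜] (A : Type u) [NonUnitalNormedRing A]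
    [NormedSpace 𝕜 A] : Prop :=
  ∀ (X : Type w) [NormedAddCommGroup X] [NormedSpace 𝕜 X] [CompleteSpace X]
    (M : Bimodule 𝕜 A X) (D : A →L[𝕜] StrongDual 𝕜 X),
    M.dual.IsDerivation D → M.dual.IsSemiInner D

/-! ## The two Arens products on the bidual -/

section Arens

variable {𝕜 : Type v} [RCLike 𝕜] {A : Type u} [NonUnitalNormedRing A] [NormedSpace 𝕜 A]
  [IsScalarTower 𝕜 A A] [SMulCommClass 𝕜 A A]

/-- `(dualRight f a) b = f (a b)`: the functional `f · a`. -/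
def dualRight (f : StrongDual 𝕜 A) (a : A) : StrongDual 𝕜 A :=
  f.comp (ContinuousLinearMap.mul 𝕜 A a)

/-- `(dualLeft a f) b = f (b a)`: the functional `a · f`. -/
def dualLeft (a : A) (f : StrongDual 𝕜 A) : StrongDual 𝕜 A :=
  f.comp ((ContinuousLinearMap.mul 𝕜 A).flip a)

theorem norm_dualRight_le (f : StrongDual 𝕜 A) (a : A) : ‖dualRight f a‖ ≤ ‖f‖ * ‖a‖ :=
  (ContinuousLinearMap.opNorm_comp_le _ _).trans
    (mul_le_mul_of_nonneg_left (ContinuousLinearMap.opNorm_mul_apply_le 𝕜 A a) (norm_nonneg _))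

theorem norm_dualLeft_le (a : A) (f : StrongDual 𝕜 A) : ‖dualLeft a f‖ ≤ ‖f‖ * ‖a‖ := by
  refine ContinuousLinearMap.opNorm_le_bound _ (by positivity) fun b => ?_
  calc ‖f (b * a)‖ ≤ ‖f‖ * ‖b * a‖ := f.le_opNorm _
    _ ≤ ‖f‖ * (‖b‖ * ‖a‖) := by gcongr; exact norm_mul_le _ _
    _ = ‖f‖ * ‖a‖ * ‖b‖ := by ring

/-- `(bidualLeft G f) a = G (f · a)`: the functional `G · f`. -/
def bidualLeft (G : StrongDual 𝕜 (StrongDual 𝕜 A)) (f : StrongDual 𝕜 A) : StrongDual 𝕜 A :=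
  LinearMap.mkContinuous
    { toFun := fun a => G (dualRight f a)
      map_add' := fun a b => by
        rw [← map_add]; congr 1; ext c; simp [dualRight]
      map_smul' := fun r a => by
        rw [RingHom.id_apply, ← map_smul]; congr 1; ext c; simp [dualRight] }
    (‖G‖ * ‖f‖) fun a => by
      calc ‖G (dualRight f a)‖ ≤ ‖G‖ * ‖dualRight f a‖ := G.le_opNorm _
        _ ≤ ‖G‖ * (‖f‖ * ‖a‖) := by gcongr; exact norm_dualRight_le f a
        _ = ‖G‖ * ‖f‖ * ‖a‖ := by ring

/-- `(bidualRight f F) a = F (a · f)`: the functional `f · F`. -/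
def bidualRight (f : StrongDual 𝕜 A) (F : StrongDual 𝕜 (StrongDual 𝕜 A)) : StrongDual 𝕜 A :=
  LinearMap.mkContinuous
    { toFun := fun a => F (dualLeft a f)
      map_add' := fun a b => by
        rw [← map_add]; congr 1; ext c; simp [dualLeft]
      map_smul' := fun r a => by
        rw [RingHom.id_apply, ← map_smul]; congr 1; ext c; simp [dualLeft] }
    (‖F‖ * ‖f‖) fun a => by
      calc ‖F (dualLeft a f)‖ ≤ ‖F‖ * ‖dualLeft a f‖ := F.le_opNorm _
        _ ≤ ‖F‖ * (‖f‖ * ‖a‖) := by gcongr; exact norm_dualLeft_le a f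
        _ = ‖F‖ * ‖f‖ * ‖a‖ := by ring

/-- The first Arens product: `⟨F □ G, f⟩ = ⟨F, G · f⟩`. -/
def arensFirst (F G : StrongDual 𝕜 (StrongDual 𝕜 A)) : StrongDual 𝕜 (StrongDual 𝕜 A) :=
  LinearMap.mkContinuous
    { toFun := fun f => F (bidualLeft G f)
      map_add' := fun f g => by
        rw [← map_add]; congr 1; ext a
        change G (dualRight (f + g) a) = G (dualRight f a) + G (dualRight g a)
        rw [← map_add]; congr 1
      map_smul' := fun r f => by
        rw [RingHom.id_apply, ← map_smul]; congr 1; ext a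
        change G (dualRight (r • f) a) = r • G (dualRight f a)
        rw [← map_smul]; congr 1 }
    (‖F‖ * ‖G‖) fun f => by
      calc ‖F (bidualLeft G f)‖ ≤ ‖F‖ * ‖bidualLeft G f‖ := F.le_opNorm _
        _ ≤ ‖F‖ * (‖G‖ * ‖f‖) := by
          gcongr; exact LinearMap.mkContinuous_norm_le _ (by positivity) _
        _ = ‖F‖ * ‖G‖ * ‖f‖ := by ring

/-- The second Arens product: `⟨F ◇ G, f⟩ = ⟨G, f · F⟩`. -/
def arensSecond (F G : StrongDual 𝕜 (StrongDual 𝕜 A)) : StrongDual 𝕜 (StrongDual 𝕜 A) :=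
  LinearMap.mkContinuous
    { toFun := fun f => G (bidualRight f F)
      map_add' := fun f g => by
        rw [← map_add]; congr 1; ext a
        change F (dualLeft a (f + g)) = F (dualLeft a f) + F (dualLeft a g)
        rw [← map_add]; congr 1
      map_smul' := fun r f => by
        rw [RingHom.id_apply, ← map_smul]; congr 1; ext a
        change F (dualLeft a (r • f)) = r • F (dualLeft a f)
        rw [← map_smul]; congr 1 }
    (‖F‖ * ‖G‖) fun f => by
      calc ‖G (bidualRight f F)‖ ≤ ‖G‖ * ‖bidualRight f F‖ := G.le_opNorm _
        _ ≤ ‖G‖ * (‖F‖ * ‖f‖) := by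
          gcongr; exact LinearMap.mkContinuous_norm_le _ (by positivity) _
        _ = ‖F‖ * ‖G‖ * ‖f‖ := by ring

theorem bidualLeft_arensFirst (F G : StrongDual 𝕜 (StrongDual 𝕜 A)) (f : StrongDual 𝕜 A) :
    bidualLeft (arensFirst F G) f = bidualLeft F (bidualLeft G f) := by
  ext a
  change F (bidualLeft G (dualRight f a)) = F (dualRight (bidualLeft G f) a)
  congr 1; ext b
  change G (dualRight (dualRight f a) b) = G (dualRight f (a * b))
  congr 1; ext c
  simp [dualRight, mul_assoc]

theorem bidualRight_arensSecond (F G : StrongDual 𝕜 (StrongDual 𝕜 A)) (f : StrongDual 𝕜 A) :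
    bidualRight f (arensSecond F G) = bidualRight (bidualRight f F) G := by
  ext a
  change G (bidualRight (dualLeft a f) F) = G (dualLeft a (bidualRight f F))
  congr 1; ext b
  change F (dualLeft b (dualLeft a f)) = F (dualLeft (b * a) f)
  congr 1; ext c
  simp [dualLeft, mul_assoc]

theorem arensFirst_assoc (F G H : StrongDual 𝕜 (StrongDual 𝕜 A)) :
    arensFirst (arensFirst F G) H = arensFirst F (arensFirst G H) := by
  ext f
  change F (bidualLeft G (bidualLeft H f)) = F (bidualLeft (arensFirst G H) f)
  rw [bidualLeft_arensFirst]

theorem arensSecond_assoc (F G H : StrongDual 𝕜 (StrongDual 𝕜 A)) :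
    arensSecond (arensSecond F G) H = arensSecond F (arensSecond G H) := by
  ext f
  change H (bidualRight f (arensSecond F G)) = H (bidualRight (bidualRight f F) G)
  rw [bidualRight_arensSecond]

theorem arensFirst_add (F G H : StrongDual 𝕜 (StrongDual 𝕜 A)) :
    arensFirst F (G + H) = arensFirst F G + arensFirst F H :=
  ContinuousLinearMap.ext fun f => map_add F (bidualLeft G f) (bidualLeft H f)

theorem arensFirst_smul (r : 𝕜) (F G : StrongDual 𝕜 (StrongDual 𝕜 A)) :
    arensFirst F (r • G) = r • arensFirst F G :=
  ContinuousLinearMap.ext fun f => map_smul F r (bidualLeft G f)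

theorem add_arensSecond (F G H : StrongDual 𝕜 (StrongDual 𝕜 A)) :
    arensSecond (F + G) H = arensSecond F H + arensSecond G H :=
  ContinuousLinearMap.ext fun f => map_add H (bidualRight f F) (bidualRight f G)

theorem smul_arensSecond (r : 𝕜) (F G : StrongDual 𝕜 (StrongDual 𝕜 A)) :
    arensSecond (r • F) G = r • arensSecond F G :=
  ContinuousLinearMap.ext fun f => map_smul G r (bidualRight f F)

theorem norm_arensFirst_le (F G : StrongDual 𝕜 (StrongDual 𝕜 A)) :
    ‖arensFirst F G‖ ≤ ‖F‖ * ‖G‖ :=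
  LinearMap.mkContinuous_norm_le _ (by positivity) _

theorem norm_arensSecond_le (F G : StrongDual 𝕜 (StrongDual 𝕜 A)) :
    ‖arensSecond F G‖ ≤ ‖F‖ * ‖G‖ :=
  LinearMap.mkContinuous_norm_le _ (by positivity) _

variable (𝕜 A)

/-- The bidual `A**` with its dual norm, equipped with the first Arens product. -/
def BidualFirst : Type (max u v) := StrongDual 𝕜 (StrongDual 𝕜 A)

instance : NormedAddCommGroup (BidualFirst 𝕜 A) :=
  inferInstanceAs (NormedAddCommGroup (StrongDual 𝕜 (StrongDual 𝕜 A)))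

/-- `A**` with the first Arens product is a (not necessarily unital) normed ring. -/
instance : NonUnitalNormedRing (BidualFirst 𝕜 A) where
  __ := (inferInstance : NormedAddCommGroup (BidualFirst 𝕜 A))
  mul F G := arensFirst (𝕜 := 𝕜) (A := A) F G
  left_distrib (F G H : StrongDual 𝕜 (StrongDual 𝕜 A)) := arensFirst_add F G H
  right_distrib (_ _ _ : StrongDual 𝕜 (StrongDual 𝕜 A)) := rfl
  zero_mul (_ : StrongDual 𝕜 (StrongDual 𝕜 A)) := rfl
  mul_zero (F : StrongDual 𝕜 (StrongDual 𝕜 A)) := ContinuousLinearMap.ext fun _ => map_zero (F : StrongDual 𝕜 (StrongDual 𝕜 A))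
  mul_assoc (F G H : StrongDual 𝕜 (StrongDual 𝕜 A)) := arensFirst_assoc F G H
  norm_mul_le (F G : StrongDual 𝕜 (StrongDual 𝕜 A)) := norm_arensFirst_le F G

instance : NormedSpace 𝕜 (BidualFirst 𝕜 A) :=
  inferInstanceAs (NormedSpace 𝕜 (StrongDual 𝕜 (StrongDual 𝕜 A)))

instance : CompleteSpace (BidualFirst 𝕜 A) :=
  inferInstanceAs (CompleteSpace (StrongDual 𝕜 (StrongDual 𝕜 A)))

instance : IsScalarTower 𝕜 (BidualFirst 𝕜 A) (BidualFirst 𝕜 A) where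
  smul_assoc _ (_ _ : StrongDual 𝕜 (StrongDual 𝕜 A)) := rfl

instance : SMulCommClass 𝕜 (BidualFirst 𝕜 A) (BidualFirst 𝕜 A) where
  smul_comm r (F G : StrongDual 𝕜 (StrongDual 𝕜 A)) := (arensFirst_smul r F G).symm

/-- The bidual `A**` with its dual norm, equipped with the second Arens product. -/
def BidualSecond : Type (max u v) := StrongDual 𝕜 (StrongDual 𝕜 A)

instance : NormedAddCommGroup (BidualSecond 𝕜 A) :=
  inferInstanceAs (NormedAddCommGroup (StrongDual 𝕜 (StrongDual 𝕜 A)))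

/-- `A**` with the second Arens product is a (not necessarily unital) normed ring. -/
instance : NonUnitalNormedRing (BidualSecond 𝕜 A) where
  __ := (inferInstance : NormedAddCommGroup (BidualSecond 𝕜 A))
  mul F G := arensSecond (𝕜 := 𝕜) (A := A) F G
  left_distrib (_ _ _ : StrongDual 𝕜 (StrongDual 𝕜 A)) := rfl
  right_distrib (F G H : StrongDual 𝕜 (StrongDual 𝕜 A)) := add_arensSecond F G H
  zero_mul (F : StrongDual 𝕜 (StrongDual 𝕜 A)) := ContinuousLinearMap.ext fun _ => map_zero (F : StrongDual 𝕜 (StrongDual 𝕜 A))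
  mul_zero (_ : StrongDual 𝕜 (StrongDual 𝕜 A)) := rfl
  mul_assoc (F G H : StrongDual 𝕜 (StrongDual 𝕜 A)) := arensSecond_assoc F G H
  norm_mul_le (F G : StrongDual 𝕜 (StrongDual 𝕜 A)) := norm_arensSecond_le F G

instance : NormedSpace 𝕜 (BidualSecond 𝕜 A) :=
  inferInstanceAs (NormedSpace 𝕜 (StrongDual 𝕜 (StrongDual 𝕜 A)))

instance : CompleteSpace (BidualSecond 𝕜 A) :=
  inferInstanceAs (CompleteSpace (StrongDual 𝕜 (StrongDual 𝕜 A)))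

instance : IsScalarTower 𝕜 (BidualSecond 𝕜 A) (BidualSecond 𝕜 A) where
  smul_assoc r (F G : StrongDual 𝕜 (StrongDual 𝕜 A)) := smul_arensSecond r F G

instance : SMulCommClass 𝕜 (BidualSecond 𝕜 A) (BidualSecond 𝕜 A) where
  smul_comm _ (_ _ : StrongDual 𝕜 (StrongDual 𝕜 A)) := rfl

end Arens

end BanachAlg

end

/-! Let `D` be a derivation from A into Y*. Arens extension makes Y*** a bimodule over A** with
either product, and the double transpose D** is a derivation from A** into it. This bimodule need
not be known to be a dual one: the canonical embedding of Y*** into its own bidual is a module map,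
so D** becomes a derivation into a dual bimodule, where semi-amenability of A** supplies η and ξ.
Composing η and ξ with the canonical map Y → Y** → Y****, which is compatible with the actions of A,
writes `D` itself as semi-inner.

The hypothesis only tests bimodules in the universe of A, while the conclusion allows any. By
Hahn–Banach, being semi-inner amounts to one inequality on finite sums with a uniform constant. If
every constant n fails, the countably many failures lie in one closed sub-bimodule small enough for
that universe, which contradicts the small case (`IsSemiAmenable.of_small`). -/

namespace BanachAlg

set_option maxSynthPendingDepth 3

open NormedSpace ContinuousLinearMap

/-! ### Arens extension of bilinear maps -/

section ArensExtension

variable {𝕜 : Type*} [RCLike 𝕜]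
variable {E F G P Q : Type*} [NormedAddCommGroup E] [NormedSpace 𝕜 E]
  [NormedAddCommGroup F] [NormedSpace 𝕜 F] [NormedAddCommGroup G] [NormedSpace 𝕜 G]
  [NormedAddCommGroup P] [NormedSpace 𝕜 P] [NormedAddCommGroup Q] [NormedSpace 𝕜 Q]

/-- The adjoint `m*` of a bounded bilinear map: `m* h x = h ∘ m x`. -/
noncomputable def bilinAdjoint (m : E →L[𝕜] F →L[𝕜] G) :
    StrongDual 𝕜 G →L[𝕜] E →L[𝕜] StrongDual 𝕜 F :=
  ((compL 𝕜 E (F →L[𝕜] G) (StrongDual 𝕜 F)).flip m).comp (compL 𝕜 F G 𝕜)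

/-- The first Arens extension `m***` of a bounded bilinear map to the biduals. -/
noncomputable def arensExtend (m : E →L[𝕜] F →L[𝕜] G) :
    StrongDual 𝕜 (StrongDual 𝕜 E) →L[𝕜] StrongDual 𝕜 (StrongDual 𝕜 F) →L[𝕜]
      StrongDual 𝕜 (StrongDual 𝕜 G) :=
  bilinAdjoint (bilinAdjoint (bilinAdjoint m))

/-- The double transpose of a bounded linear map. -/
noncomputable def bidualMap (T : E →L[𝕜] F) :
    StrongDual 𝕜 (StrongDual 𝕜 E) →L[𝕜] StrongDual 𝕜 (StrongDual 𝕜 F) :=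
  (compL 𝕜 (StrongDual 𝕜 F) (StrongDual 𝕜 E) 𝕜).flip ((compL 𝕜 E F 𝕜).flip T)

/-- Evaluated at a functional `f`, both bracketings unfold to the same iterated expression, with `Φ`
outermost in x, then `Ψ` in y, then `Θ` in z, so the identity need only be checked on elements. No
weak-* limits are involved. -/
theorem arensExtend_assoc {m₁ : E →L[𝕜] F →L[𝕜] P} {m₂ : P →L[𝕜] G →L[𝕜] Q}
    {R : Type*} [NormedAddCommGroup R] [NormedSpace 𝕜 R]
    {m₃ : F →L[𝕜] G →L[𝕜] R} {m₄ : E →L[𝕜] R →L[𝕜] Q}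
    (h : ∀ x y z, m₂ (m₁ x y) z = m₄ x (m₃ y z)) (Φ : StrongDual 𝕜 (StrongDual 𝕜 E))
    (Ψ : StrongDual 𝕜 (StrongDual 𝕜 F)) (Θ : StrongDual 𝕜 (StrongDual 𝕜 G)) :
    arensExtend m₂ (arensExtend m₁ Φ Ψ) Θ = arensExtend m₄ Φ (arensExtend m₃ Ψ Θ) := by
  ext f
  refine congrArg Φ (ContinuousLinearMap.ext fun x => congrArg Ψ
    (ContinuousLinearMap.ext fun y => congrArg Θ (ContinuousLinearMap.ext fun z => ?_)))
  exact congrArg f (h x y z)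

/-- If `T (m x y) = m₁ x (T y) + m₂ (T x) y`, the same holds for the extensions. -/
theorem bidualMap_arensExtend {m : E →L[𝕜] E →L[𝕜] E} {m₁ : E →L[𝕜] F →L[𝕜] F}
    {m₂ : F →L[𝕜] E →L[𝕜] F} {T : E →L[𝕜] F}
    (h : ∀ x y, T (m x y) = m₁ x (T y) + m₂ (T x) y)
    (Φ Ψ : StrongDual 𝕜 (StrongDual 𝕜 E)) :
    bidualMap T (arensExtend m Φ Ψ) =
      arensExtend m₁ Φ (bidualMap T Ψ) + arensExtend m₂ (bidualMap T Φ) Ψ := by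
  ext f
  change Φ _ = Φ _ + Φ _
  rw [← map_add]
  refine congrArg Φ (ContinuousLinearMap.ext fun x => ?_)
  change Ψ _ = Ψ _ + Ψ _
  rw [← map_add]
  refine congrArg Ψ (ContinuousLinearMap.ext fun y => ?_)
  change f (T (m x y)) = f (m₁ x (T y)) + f (m₂ (T x) y)
  rw [h, map_add]

end ArensExtension

/-! ### Bidual bimodules and extended derivations -/

section BidualModule

variable {𝕜 : Type v} [RCLike 𝕜] {A B : Type u} [NonUnitalNormedRing A] [NormedSpace 𝕜 A]
  [IsScalarTower 𝕜 A A] [SMulCommClass 𝕜 A A] [NonUnitalNormedRing B] [NormedSpace 𝕜 B]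
variable {Z : Type w} [NormedAddCommGroup Z] [NormedSpace 𝕜 Z]

/-- The bidual of an `A`-bimodule as a bimodule over `B`, where `B` maps into `A**` with the first
Arens product. -/
noncomputable def Bimodule.bidualFirst (M : Bimodule 𝕜 A Z)
    (e : B →L[𝕜] StrongDual 𝕜 (StrongDual 𝕜 A))
    (he : ∀ F G, e (F * G) = arensExtend (ContinuousLinearMap.mul 𝕜 A) (e F) (e G)) :
    Bimodule 𝕜 B (StrongDual 𝕜 (StrongDual 𝕜 Z)) where
  left := (arensExtend M.left).comp e
  -- The flip puts the module variable outermost: every action must evaluate its left factor first,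
  -- as the first Arens product does.
  right := (arensExtend M.right.flip).flip.comp e
  left_mul F G Φ := by
    change arensExtend M.left (e (F * G)) Φ = _
    rw [he]
    exact arensExtend_assoc (fun a b x => M.left_mul a b x) _ _ _
  right_mul F G Φ := by
    change arensExtend M.right.flip Φ (e (F * G)) = _
    rw [he]
    exact (arensExtend_assoc (fun x a b => (M.right_mul a b x).symm) _ _ _).symm
  left_right F G Φ := arensExtend_assoc (fun a x b => M.left_right a b x) _ _ _

/-- The bidual of an `A`-bimodule as a bimodule over `B`, where `B` maps into `A**` with the second
Arens product. -/
noncomputable def Bimodule.bidualSecond (M : Bimodule 𝕜 A Z)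
    (e : B →L[𝕜] StrongDual 𝕜 (StrongDual 𝕜 A))
    (he : ∀ F G, e (F * G) = arensExtend (ContinuousLinearMap.mul 𝕜 A).flip (e G) (e F)) :
    Bimodule 𝕜 B (StrongDual 𝕜 (StrongDual 𝕜 Z)) where
  -- The second Arens product evaluates its right factor outermost, so here the left action is the
  -- one to flip.
  left := (arensExtend M.left.flip).flip.comp e
  right := (arensExtend M.right).comp e
  left_mul F G Φ := by
    change arensExtend M.left.flip Φ (e (F * G)) = _
    rw [he]
    exact (arensExtend_assoc (fun x b a => (M.left_mul a b x).symm) _ _ _).symm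
  right_mul F G Φ := by
    change arensExtend M.right (e (F * G)) Φ = _
    rw [he]
    exact arensExtend_assoc (fun b a x => M.right_mul a b x) _ _ _
  left_right F G Φ := (arensExtend_assoc (fun b x a => (M.left_right a b x).symm) _ _ _).symm

theorem Bimodule.IsDerivation.bidualFirst {M : Bimodule 𝕜 A Z} {D : A →L[𝕜] Z}
    (hD : M.IsDerivation D) (e : B →L[𝕜] StrongDual 𝕜 (StrongDual 𝕜 A))
    (he : ∀ F G, e (F * G) = arensExtend (ContinuousLinearMap.mul 𝕜 A) (e F) (e G)) :
    (M.bidualFirst e he).IsDerivation ((bidualMap D).comp e) := fun F G => by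
  change bidualMap D (e (F * G)) = _
  rw [he, bidualMap_arensExtend (m := ContinuousLinearMap.mul 𝕜 A) (m₁ := M.left) (m₂ := M.right.flip)
    fun a b => (hD a b).trans (add_comm _ _), add_comm]
  rfl

theorem Bimodule.IsDerivation.bidualSecond {M : Bimodule 𝕜 A Z} {D : A →L[𝕜] Z}
    (hD : M.IsDerivation D) (e : B →L[𝕜] StrongDual 𝕜 (StrongDual 𝕜 A))
    (he : ∀ F G, e (F * G) = arensExtend (ContinuousLinearMap.mul 𝕜 A).flip (e G) (e F)) :
    (M.bidualSecond e he).IsDerivation ((bidualMap D).comp e) := fun F G => by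
  change bidualMap D (e (F * G)) = _
  rw [he, bidualMap_arensExtend (m := (ContinuousLinearMap.mul 𝕜 A).flip) (m₁ := M.right) (m₂ := M.left.flip) fun b a => hD a b]
  rfl

theorem Bimodule.IsDerivation.inclusion {N : Bimodule 𝕜 B Z} {D : B →L[𝕜] Z}
    (hD : N.IsDerivation D) :
    N.dual.dual.IsDerivation ((inclusionInDoubleDual 𝕜 Z).comp D) := fun F G => by
  ext f
  exact (congrArg f (hD F G)).trans (map_add f _ _)

end BidualModule

/-! ### Descending semi-innerness to the smaller algebra -/

section Descent

variable {𝕜 : Type} [RCLike 𝕜] {A B : Type u} [NonUnitalNormedRing A] [NormedSpace 𝕜 A]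
  [NonUnitalNormedRing B] [NormedSpace 𝕜 B]

/-- If every dual bimodule `Y*` of `A` maps into a bimodule `V` over the semi-amenable algebra `B`,
compatibly with the actions and with an extension of the given derivation, and `Y` maps compatibly
into `V*`, then `A` is semi-amenable. -/
theorem IsSemiAmenable.descend (hB : IsSemiAmenable.{u, 0, u} 𝕜 B) (ι : A → B)
    (H : ∀ (Y : Type u) [NormedAddCommGroup Y] [NormedSpace 𝕜 Y] (M : Bimodule 𝕜 A Y)
      (D : A →L[𝕜] StrongDual 𝕜 Y), M.dual.IsDerivation D →
      ∃ (V : Type u) (_ : NormedAddCommGroup V) (_ : NormedSpace 𝕜 V) (N : Bimodule 𝕜 B V)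
        (D' : B →L[𝕜] V) (j : Y →L[𝕜] StrongDual 𝕜 V), N.IsDerivation D' ∧
        (∀ a y, j y (D' (ι a)) = D a y) ∧
        (∀ a y v, j y (N.left (ι a) v) = j (M.right a y) v) ∧
        (∀ a y v, j y (N.right (ι a) v) = j (M.left a y) v)) :
    IsSemiAmenable.{u, 0, u} 𝕜 A := by
  intro Y _ _ _ M D hD
  obtain ⟨V, _, _, N, D', j, hD', hι, hl, hr⟩ := H Y M D hD
  -- Passing from `V` to `V**` makes the target a dual bimodule, whatever `V` is.
  obtain ⟨η, ξ, h⟩ := hB (StrongDual 𝕜 V) N.dual _ hD'.inclusion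
  refine ⟨η.comp j, ξ.comp j, fun a => ContinuousLinearMap.ext fun y => ?_⟩
  have h1 : N.dual.right (ι a) (j y) = j (M.right a y) := ContinuousLinearMap.ext (hl a y)
  have h2 : N.dual.left (ι a) (j y) = j (M.left a y) := ContinuousLinearMap.ext (hr a y)
  have h3 : j y (D' (ι a)) = η (N.dual.right (ι a) (j y)) - ξ (N.dual.left (ι a) (j y)) :=
    congrArg (fun T => T (j y)) (h (ι a))
  rw [hι, h1, h2] at h3
  exact h3

end Descent

/-! ### Independence of the universe of test bimodules -/

section SmallModules

variable {𝕜 : Type v} [RCLike 𝕜] {A : Type u} [NonUnitalNormedRing A] [NormedSpace 𝕜 A]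
variable {X : Type w} [NormedAddCommGroup X] [NormedSpace 𝕜 X]

/-- A Hahn–Banach criterion: a linear functional factors boundedly through a linear map that
dominates it. -/
theorem exists_strongDual_comp_eq {V E : Type*} [AddCommGroup V] [Module 𝕜 V]
    [NormedAddCommGroup E] [NormedSpace 𝕜 E] (T : V →ₗ[𝕜] E) (φ : V →ₗ[𝕜] 𝕜) (K : ℝ)
    (h : ∀ v, ‖φ v‖ ≤ K * ‖T v‖) : ∃ Λ : StrongDual 𝕜 E, ∀ v, Λ (T v) = φ v := by
  have hker : LinearMap.ker T ≤ LinearMap.ker φ := fun v hv => by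
    have := h v
    rw [LinearMap.mem_ker.1 hv, norm_zero, mul_zero] at this
    exact LinearMap.mem_ker.2 (norm_le_zero_iff.1 this)
  -- The bound makes `φ` vanish on the kernel of `T`, so it descends to a bounded functional on the
  -- range, ready to be extended.
  let ψ : LinearMap.range T →ₗ[𝕜] 𝕜 :=
    ((LinearMap.ker T).liftQ φ hker).comp T.quotKerEquivRange.symm.toLinearMap
  have hψ : ∀ v, ψ ⟨T v, v, rfl⟩ = φ v := fun v => by
    have : T.quotKerEquivRange.symm ⟨T v, v, rfl⟩ = (LinearMap.ker T).mkQ v :=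
      T.quotKerEquivRange_symm_apply_image v _
    simp [ψ, this]
  have hb : ∀ x, ‖ψ x‖ ≤ K * ‖x‖ := by
    rintro ⟨_, v, rfl⟩
    rw [hψ]
    exact h v
  obtain ⟨Λ, hΛ, -⟩ := exists_extension_norm_eq (LinearMap.range T) (ψ.mkContinuous K hb)
  exact ⟨Λ, fun v => (hΛ ⟨T v, v, rfl⟩).trans (hψ v)⟩

/-- The pair (η, -ξ) is a bounded functional on X × X taking (x · a, a · x) to `D a x`. Hahn–Banach
yields one exactly when the prescribed values are bounded on the span of these pairs. -/
theorem Bimodule.isSemiInner_dual_iff (M : Bimodule 𝕜 A X) (D : A →L[𝕜] StrongDual 𝕜 X) :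
    M.dual.IsSemiInner D ↔ ∃ K : ℝ, ∀ (s : Finset A) (x : A → X),
      ‖∑ a ∈ s, D a (x a)‖ ≤ K * ‖(∑ a ∈ s, M.right a (x a), ∑ a ∈ s, M.left a (x a))‖ := by
  constructor
  · rintro ⟨η, ξ, h⟩
    refine ⟨‖η.coprod (-ξ)‖, fun s x => ?_⟩
    refine le_of_eq_of_le (congrArg norm ?_) ((η.coprod (-ξ)).le_opNorm _)
    rw [coprod_apply, map_sum, map_sum, ← Finset.sum_add_distrib]
    refine Finset.sum_congr rfl fun a _ => ?_
    rw [h a]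
    exact sub_eq_add_neg _ _
  · rintro ⟨K, hK⟩
    let φ : (A →₀ X) →ₗ[𝕜] 𝕜 := Finsupp.lsum ℕ fun a => (D a : X →ₗ[𝕜] 𝕜)
    let T : (A →₀ X) →ₗ[𝕜] X × X :=
      (Finsupp.lsum ℕ fun a => (M.right a : X →ₗ[𝕜] X)).prod
        (Finsupp.lsum ℕ fun a => (M.left a : X →ₗ[𝕜] X))
    obtain ⟨Λ, hΛ⟩ := exists_strongDual_comp_eq T φ K fun v => hK v.support v
    refine ⟨Λ.comp (.inl 𝕜 X X), -Λ.comp (.inr 𝕜 X X), fun a =>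
      ContinuousLinearMap.ext fun x => ?_⟩
    have h := hΛ (Finsupp.single a x)
    have hT : T (Finsupp.single a x) = (M.right a x, M.left a x) := by simp [T]
    have hφ : φ (Finsupp.single a x) = D a x := by simp [φ]
    rw [hT, hφ] at h
    rw [← h]
    change _ = Λ (M.right a x, 0) - -Λ (0, M.left a x)
    rw [sub_neg_eq_add, ← map_add]
    simp

/-- Pulling a bimodule structure back along an isometry with invariant range. -/
theorem Bimodule.exists_restrict (M : Bimodule 𝕜 A X) {Y : Type*} [NormedAddCommGroup Y]
    [NormedSpace 𝕜 Y] (j : Y →ₗᵢ[𝕜] X) (hl : ∀ a y, ∃ z, j z = M.left a (j y))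
    (hr : ∀ a y, ∃ z, j z = M.right a (j y)) :
    ∃ N : Bimodule 𝕜 A Y, (∀ a y, j (N.left a y) = M.left a (j y)) ∧
      ∀ a y, j (N.right a y) = M.right a (j y) := by
  have key : ∀ m : A →L[𝕜] X →L[𝕜] X, (∀ a y, ∃ z, j z = m a (j y)) →
      ∃ n : A →L[𝕜] Y →L[𝕜] Y, ∀ a y, j (n a y) = m a (j y) := by
    intro m hm
    choose n hn using hm
    refine ⟨(LinearMap.mk₂ 𝕜 n ?_ ?_ ?_ ?_).mkContinuous₂ ‖m‖ ?_, hn⟩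
    · exact fun a b y => j.injective (by simp [hn])
    · exact fun c a y => j.injective (by simp [hn])
    · exact fun a x y => j.injective (by simp [hn])
    · exact fun c a y => j.injective (by simp [hn])
    · intro a y
      rw [LinearMap.mk₂_apply, ← j.norm_map, hn, ← j.norm_map y]
      exact m.le_opNorm₂ a (j y)
  obtain ⟨l, hl⟩ := key M.left hl
  obtain ⟨r, hr⟩ := key M.right hr
  refine ⟨⟨l, r, fun a b y => j.injective ?_, fun a b y => j.injective ?_,
    fun a b y => j.injective ?_⟩, hl, hr⟩
  · simp [hl, M.left_mul]
  · simp [hr, M.right_mul]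
  · simp [hl, hr, M.left_right]

/-- Closure points are limits of sequences in `s`, and the sequences form a small type. -/
theorem small_closure {E : Type*} [TopologicalSpace E] [T2Space E] [FrechetUrysohnSpace E]
    (s : Set E) [Small.{u} s] : Small.{u} (closure s) := by
  let S : Type _ := {x : ℕ → s // ∃ a, Filter.Tendsto (fun n => (x n : E)) Filter.atTop (nhds a)}
  have hsub : closure s ⊆ Set.range fun x : S => x.2.choose := fun a ha => by
    obtain ⟨x, hx, hxa⟩ := mem_closure_iff_seq_limit.1 ha
    have h : ∃ b, Filter.Tendsto x Filter.atTop (nhds b) := ⟨a, hxa⟩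
    exact ⟨⟨fun n => ⟨x n, hx n⟩, h⟩, tendsto_nhds_unique h.choose_spec hxa⟩
  exact small_subset hsub

/-- A small family in a bimodule lies in a small closed sub-bimodule. -/
theorem Bimodule.exists_small_submodule {𝕜 : Type} [RCLike 𝕜] {A : Type u}
    [NonUnitalNormedRing A] [NormedSpace 𝕜 A] {X : Type w} [NormedAddCommGroup X]
    [NormedSpace 𝕜 X] (M : Bimodule 𝕜 A X) {J : Type u} (x : J → X) :
    ∃ Y : Submodule 𝕜 X, Small.{u} Y ∧ IsClosed (Y : Set X) ∧ (∀ i, x i ∈ Y) ∧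
      (∀ a, ∀ y ∈ Y, M.left a y ∈ Y) ∧ ∀ a, ∀ y ∈ Y, M.right a y ∈ Y := by
  -- Since A may lack a unit, `none` stands for an adjoined one, acting as the identity.
  let lact : Option A → X →L[𝕜] X := fun o => o.elim (.id 𝕜 X) M.left
  let ract : Option A → X →L[𝕜] X := fun o => o.elim (.id 𝕜 X) M.right
  let g : J × Option A × Option A → X := fun i => lact i.2.1 (ract i.2.2 (x i.1))
  let S : Submodule 𝕜 X := LinearMap.range (Finsupp.linearCombination 𝕜 g)
  have hS : Small.{u} S := small_range (Finsupp.linearCombination 𝕜 g)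
  have hspan : S = Submodule.span 𝕜 (Set.range g) := Finsupp.range_linearCombination 𝕜
  have hinv : ∀ T : X →L[𝕜] X, (∀ i, T (g i) ∈ Set.range g) →
      ∀ y ∈ S.topologicalClosure, T y ∈ S.topologicalClosure := by
    intro T hT y hy
    have hST : Set.MapsTo T S S := by
      rw [hspan]
      intro z hz
      have : Submodule.span 𝕜 (Set.range g) ≤
          (Submodule.span 𝕜 (Set.range g)).comap (T : X →ₗ[𝕜] X) :=
        Submodule.span_le.2 (by rintro _ ⟨i, rfl⟩; exact Submodule.subset_span (hT i))
      exact this hz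
    exact map_mem_closure T.continuous hy hST
  refine ⟨S.topologicalClosure, ?_, S.isClosed_topologicalClosure, fun i => ?_,
    fun a => hinv _ ?_, fun a => hinv _ ?_⟩
  · have : Small.{u} (S : Set X) := hS
    exact small_closure (S : Set X)
  · refine S.le_topologicalClosure ?_
    rw [hspan]
    exact Submodule.subset_span ⟨(i, none, none), rfl⟩
  · rintro ⟨i, _ | b, c⟩
    · exact ⟨(i, some a, c), rfl⟩
    · exact ⟨(i, some (a * b), c), M.left_mul a b _⟩
  · rintro ⟨i, b, _ | c⟩
    · refine ⟨(i, b, some a), ?_⟩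
      cases b with
      | none => rfl
      | some b => exact (M.left_right b a _).symm
    · refine ⟨(i, b, some (c * a)), ?_⟩
      cases b with
      | none => exact M.right_mul c a _
      | some b =>
        change M.left b (M.right (c * a) (x i)) = M.right a (M.left b (M.right c (x i)))
        rw [M.right_mul, M.left_right]

/-- Semi-amenability may be tested on bimodules in the universe of the algebra. -/
theorem IsSemiAmenable.of_small {𝕜 : Type} [RCLike 𝕜] {A : Type u} [NonUnitalNormedRing A]
    [NormedSpace 𝕜 A] (hA : IsSemiAmenable.{u, 0, u} 𝕜 A) : IsSemiAmenable.{u, 0, w} 𝕜 A := by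
  intro X _ _ _ M D hD
  rw [M.isSemiInner_dual_iff]
  by_contra! hcon
  -- For each n, a finite family violating the criterion with constant n.
  choose s x hx using fun n : ℕ => hcon n
  obtain ⟨Y, hsmall, hclosed, hxY, hlY, hrY⟩ :=
    M.exists_small_submodule fun i : ℕ × A => x i.1 i.2
  let e : Shrink.{u} Y ≃ₗᵢ[𝕜] Y :=
    { (equivShrink Y).symm.linearEquiv 𝕜 with norm_map' := fun _ => rfl }
  have : CompleteSpace Y := hclosed.completeSpace_coe
  have : CompleteSpace (Shrink.{u} Y) :=
    (completeSpace_congr (e := e.toEquiv) e.isometry.isUniformEmbedding).2 inferInstance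
  let j : Shrink.{u} Y →ₗᵢ[𝕜] X := Y.subtypeₗᵢ.comp e.toLinearIsometry
  have hj : ∀ z ∈ Y, ∃ y, j y = z := fun z hz =>
    ⟨e.symm ⟨z, hz⟩, congrArg Subtype.val (e.apply_symm_apply ⟨z, hz⟩)⟩
  have hjY : ∀ y, j y ∈ Y := fun y => (e y).2
  obtain ⟨N, hNl, hNr⟩ := M.exists_restrict j (fun a y => hj _ (hlY a _ (hjY y)))
    fun a y => hj _ (hrY a _ (hjY y))
  let D' : A →L[𝕜] StrongDual 𝕜 (Shrink.{u} Y) :=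
    ((compL 𝕜 (Shrink.{u} Y) X 𝕜).flip j.toContinuousLinearMap).comp D
  have hD' : N.dual.IsDerivation D' := fun a b => ContinuousLinearMap.ext fun y => by
    have h := congrArg (fun T => T (j y)) (hD a b)
    change D (a * b) (j y) = D a (j (N.left b y)) + D b (j (N.right a y))
    rw [hNl, hNr]
    exact h
  obtain ⟨K, hK⟩ := (N.isSemiInner_dual_iff D').1 (hA _ N D' hD')
  -- The bound `K` on the sub-bimodule applies to the n-th violating family, which contradicts `K ≤
  -- n`.
  obtain ⟨n, hn⟩ := exists_nat_ge K
  choose y hy using fun a => hj _ (hxY (n, a))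
  have h := hK (s n) y
  have hnorm : ‖(∑ a ∈ s n, N.right a (y a), ∑ a ∈ s n, N.left a (y a))‖ =
      ‖(∑ a ∈ s n, M.right a (x n a), ∑ a ∈ s n, M.left a (x n a))‖ := by
    simp only [Prod.norm_mk, ← hy, ← hNl, ← hNr, ← map_sum, j.norm_map]
  have hval : ∑ a ∈ s n, D' a (y a) = ∑ a ∈ s n, D a (x n a) :=
    Finset.sum_congr rfl fun a _ => congrArg (D a) (hy a)
  rw [hnorm, hval] at h
  exact absurd ((hx n).trans_le h) (not_lt.2 (by gcongr))

end SmallModules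

/-! ### The two Arens products -/

section BidualProducts

variable {𝕜 : Type} [RCLike 𝕜] {A : Type u} [NonUnitalNormedRing A] [NormedSpace 𝕜 A]
  [IsScalarTower 𝕜 A A] [SMulCommClass 𝕜 A A]

theorem IsSemiAmenable.of_bidualFirst (h : IsSemiAmenable.{u, 0, u} 𝕜 (BidualFirst 𝕜 A)) :
    IsSemiAmenable.{u, 0, w} 𝕜 A := by
  let e : BidualFirst 𝕜 A →L[𝕜] StrongDual 𝕜 (StrongDual 𝕜 A) :=
    ContinuousLinearMap.id 𝕜 (StrongDual 𝕜 (StrongDual 𝕜 A))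
  have he : ∀ F G, e (F * G) = arensExtend (ContinuousLinearMap.mul 𝕜 A) (e F) (e G) :=
    fun _ _ => rfl
  refine (h.descend (fun a => (inclusionInDoubleDual 𝕜 A a : BidualFirst 𝕜 A)) ?_).of_small
  intro Y _ _ M D hD
  -- On canonical images of A and Y the iterated evaluations collapse to the original actions and
  -- derivation, so the compatibilities hold by `rfl`.
  exact ⟨StrongDual 𝕜 (StrongDual 𝕜 (StrongDual 𝕜 Y)), inferInstance, inferInstance,
    M.dual.bidualFirst e he, (bidualMap D).comp e,
    (inclusionInDoubleDual 𝕜 (StrongDual 𝕜 (StrongDual 𝕜 Y))).comp (inclusionInDoubleDual 𝕜 Y),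
    hD.bidualFirst e he, fun _ _ => rfl, fun _ _ _ => rfl, fun _ _ _ => rfl⟩

theorem IsSemiAmenable.of_bidualSecond (h : IsSemiAmenable.{u, 0, u} 𝕜 (BidualSecond 𝕜 A)) :
    IsSemiAmenable.{u, 0, w} 𝕜 A := by
  let e : BidualSecond 𝕜 A →L[𝕜] StrongDual 𝕜 (StrongDual 𝕜 A) :=
    ContinuousLinearMap.id 𝕜 (StrongDual 𝕜 (StrongDual 𝕜 A))
  have he : ∀ F G, e (F * G) = arensExtend (ContinuousLinearMap.mul 𝕜 A).flip (e G) (e F) :=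
    fun _ _ => rfl
  refine (h.descend (fun a => (inclusionInDoubleDual 𝕜 A a : BidualSecond 𝕜 A)) ?_).of_small
  intro Y _ _ M D hD
  exact ⟨StrongDual 𝕜 (StrongDual 𝕜 (StrongDual 𝕜 Y)), inferInstance, inferInstance,
    M.dual.bidualSecond e he, (bidualMap D).comp e,
    (inclusionInDoubleDual 𝕜 (StrongDual 𝕜 (StrongDual 𝕜 Y))).comp (inclusionInDoubleDual 𝕜 Y),
    hD.bidualSecond e he, fun _ _ => rfl, fun _ _ _ => rfl, fun _ _ _ => rfl⟩

end BidualProducts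

end BanachAlg

theorem theorem2p23 {𝕜 : Type} [RCLike 𝕜] {A : Type u} [NonUnitalNormedRing A]
    [NormedSpace 𝕜 A] [IsScalarTower 𝕜 A A] [SMulCommClass 𝕜 A A] [CompleteSpace A] :
    (BanachAlg.IsSemiAmenable.{u, 0, u} 𝕜 (BanachAlg.BidualFirst 𝕜 A) →
      BanachAlg.IsSemiAmenable.{u, 0, w} 𝕜 A) ∧
    (BanachAlg.IsSemiAmenable.{u, 0, u} 𝕜 (BanachAlg.BidualSecond 𝕜 A) →
      BanachAlg.IsSemiAmenable.{u, 0, w} 𝕜 A) :=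
  ⟨fun h => h.of_bidualFirst, fun h => h.of_bidualSecond⟩
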